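/- Call a subset of $\mathbb{R}^2$ a \emph{tile} if it is a simply connected closed polygon all of whose sides are parallel to the coordinate axes, and say that it is \emph{tall} if it has height $1$, i.e. its projection to the vertical axis is an interval of length $1$. A \emph{tiling} of a region $\Gamma\subset\mathbb{R}^2$ with a finite set $T$ of tiles is a collection of translates of tiles in $T$ whose interiors are pairwise disjoint and whose union is $\Gamma$. For $a>0$ let $R_a=[0,a]\times[0,1]$, and let $R_0=\varnothing$ (which has exactly one tiling, the empty one). A function $f:\mathbb{N}\to\mathbb{N}$, where $\mathbb{N}=\{0,1,2,\dots\}$, is a \emph{tile counting function} if there are a real number $\varepsilon\ge 0$ and a finite set $T$ of tall tiles such that, for every $n\in\mathbb{N}$, the number of tilings of $R_{n+\varepsilon}$ with $T$ is finite and equal to $f(n)$. The following functions $\mathbb{N}\to\mathbb{N}$ are tile counting functions: (i) every function $f_1$ with finite support; (ii) every periodic function $f_2$, i.e. one for which there is an integer $p\ge 1$ with $f_2(n+p)=f_2(n)$ for all $n\in\mathbb{N}$; (iii) every polynomial function $f_3(n)=a_pn^p+\dots+a_1n+a_0$ with coefficients $a_i\in\mathbb{N}$; (iv) $f_4(n)=m^n$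 for every $m\in\mathbb{N}$ (with $0^0=1$); (v) $f_5(n)=m^n-1$ for every $m\in\mathbb{N}$ with $m\ge 1$. -/

import Mathlib

namespace IrrationalTiling

/-- An axis-parallel simply connected closed polygon in the plane: a finite union of
nondegenerate closed axis-parallel rectangles `[a₁, b₁] × [a₂, b₂]` (the pairs `(a, b)` in `B`)
that is simply connected and has connected interior. (Connectedness of the interior
excludes pieces that meet only at a corner; with simple connectedness it says
that the set is bounded by one simple closed axis-parallel curve.) -/
structure IsTile (τ : Set (ℝ × ℝ)) : Prop where
  exists_rectangles : ∃ B : Finset ((ℝ × ℝ) × (ℝ × ℝ)),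
    (∀ r ∈ B, r.1.1 < r.2.1 ∧ r.1.2 < r.2.2) ∧ τ = ⋃ r ∈ B, Set.Icc r.1 r.2
  connected_interior : IsConnected (interior τ)
  simplyConnected : IsSimplyConnected τ

/-- A tile of height `1`: its projection to the vertical axis is an interval of length `1`. -/
structure IsTallTile (τ : Set (ℝ × ℝ)) : Prop extends IsTile τ where
  height_one : ∃ y : ℝ, Prod.snd '' τ = Set.Icc y (y + 1)

/-- A tiling of the region `Γ` with the tiles in `T`: a collection of translates of elements
of `T` with pairwise disjoint interiors whose union is `Γ`. -/
structure IsTiling (T : Set (Set (ℝ × ℝ))) (Γ : Set (ℝ × ℝ)) (C : Set (Set (ℝ × ℝ))) :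
    Prop where
  translate : ∀ σ ∈ C, ∃ τ ∈ T, ∃ v : ℝ × ℝ, σ = (fun p => v + p) '' τ
  nonoverlapping : ∀ σ ∈ C, ∀ σ' ∈ C, σ ≠ σ' → Disjoint (interior σ) (interior σ')
  covers : ⋃₀ C = Γ

/-- The rectangle of height `1` and length `a`: this is `[0, a] × [0, 1]` if `a > 0`, and it is
empty if `a ≤ 0` (so that the rectangle of length `0` has exactly one tiling, the empty one). -/
def rectangle (a : ℝ) : Set (ℝ × ℝ) :=
  closure (Set.Ioo 0 a ×ˢ Set.Ioo 0 1)

/-- `f` is a tile counting function: for a fixed `ε ≥ 0` and a fixed finite set `T` of tiles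
of height `1`, the number of tilings of the rectangle of height `1` and length `n + ε` with
the tiles in `T` is finite and equal to `f n`, for every `n`. -/
def IsTileCountingFunction (f : ℕ → ℕ) : Prop :=
  ∃ ε : ℝ, 0 ≤ ε ∧ ∃ T : Set (Set (ℝ × ℝ)), T.Finite ∧ (∀ τ ∈ T, IsTallTile τ) ∧
    ∀ n : ℕ, {C | IsTiling T (rectangle (n + ε)) C}.encard = f n

end IrrationalTiling

namespace IrrationalTiling

open Set

/-! Tiles serve as edges of a finite directed graph whose vertices are boundary curves. Curve `k` is
a vertical line with one rectangular bump of depth 1/2 to the left; distinct curves have bumps at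
disjoint heights, and curve 0 is straight within the strip. A tile is the region between two curves,
of width √2 if its left curve is straight and 1 otherwise. Bumps must match, so a tiling is a walk
read from left to right (`IsTiling.exists_first`, `IsTiling.diff_first`); this gives the recursion
`tilingCount_eq_sum`.

For length n + 1 + √2 the first tile has width √2 and leaves the integral length n + 1.
Irrationality of √2 then forbids meeting the straight line before the end
(`tilingCount_zero_eq_zero`), so tilings are walks through n + 1 further tiles of width 1. Their
number is Σ uᵢ gᵢ(n), where gᵢ(0) ∈ {0, 1} and gᵢ(n+1) = Σ Aᵢⱼ gⱼ(n) is any such system over ℕ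
(`isTileCountingFunction_of_recurrence`). All five families have this form. -/

/-! ### Boundary curves -/

/-- The lower end of the `k`-th bump; the bump with `k = 0` lies above height `1`. -/
noncomputable def bumpLo (k : ℕ) : ℝ := 2 / (4 * k + 1)

/-- The upper end of the `k`-th bump. -/
noncomputable def bumpHi (k : ℕ) : ℝ := 3 / (6 * k + 1)

open Classical in
/-- The `k`-th boundary curve, as the left boundary of a closed set. -/
noncomputable def leftEdge (k : ℕ) (y : ℝ) : ℝ :=
  if y ∈ Icc (bumpLo k) (bumpHi k) then -(1 / 2) else 0

open Classical in
/-- The `k`-th boundary curve, as the right boundary of a closed set. -/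
noncomputable def rightEdge (k : ℕ) (y : ℝ) : ℝ :=
  if y ∈ Ioo (bumpLo k) (bumpHi k) then -(1 / 2) else 0

/-- The part of the strip of height `1` between the `i`-th curve at position `s` and the
`j`-th curve at position `t`. -/
def shape (i : ℕ) (s : ℝ) (j : ℕ) (t : ℝ) : Set (ℝ × ℝ) :=
  {p | p.2 ∈ Icc (0 : ℝ) 1 ∧ s + leftEdge i p.2 ≤ p.1 ∧ p.1 ≤ t + rightEdge j p.2}

/-- An open version of `shape`. -/
def openShape (i : ℕ) (s : ℝ) (j : ℕ) (t : ℝ) : Set (ℝ × ℝ) :=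
  {p | p.2 ∈ Ioo (0 : ℝ) 1 ∧ s + rightEdge i p.2 < p.1 ∧ p.1 < t + leftEdge j p.2}

theorem bumpLo_lt_bumpHi (k : ℕ) : bumpLo k < bumpHi k := by
  unfold bumpLo bumpHi
  rw [div_lt_div_iff₀ (by positivity) (by positivity)]
  linarith

theorem bumpLo_pos (k : ℕ) : 0 < bumpLo k := by unfold bumpLo; positivity

theorem one_lt_bumpLo_zero : 1 < bumpLo 0 := by norm_num [bumpLo]

theorem bumpHi_lt {k : ℕ} (hk : k ≠ 0) : bumpHi k < 1 / 2 := by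
  have : (1 : ℝ) ≤ k := by exact_mod_cast Nat.one_le_iff_ne_zero.2 hk
  unfold bumpHi
  rw [div_lt_div_iff₀ (by positivity) (by positivity)]
  linarith

theorem leftEdge_le_rightEdge (k : ℕ) (y : ℝ) : leftEdge k y ≤ rightEdge k y := by
  unfold leftEdge rightEdge
  split_ifs with h h' h'
  · rfl
  · norm_num
  · exact absurd (Ioo_subset_Icc_self h') h
  · rfl

theorem rightEdge_nonpos (k : ℕ) (y : ℝ) : rightEdge k y ≤ 0 := by
  unfold rightEdge; split_ifs <;> norm_num

theorem leftEdge_nonpos (k : ℕ) (y : ℝ) : leftEdge k y ≤ 0 :=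
  (leftEdge_le_rightEdge k y).trans (rightEdge_nonpos k y)

theorem neg_half_le_leftEdge (k : ℕ) (y : ℝ) : -(1 / 2) ≤ leftEdge k y := by
  unfold leftEdge; split_ifs <;> norm_num

theorem neg_half_le_rightEdge (k : ℕ) (y : ℝ) : -(1 / 2) ≤ rightEdge k y :=
  (neg_half_le_leftEdge k y).trans (leftEdge_le_rightEdge k y)

theorem leftEdge_eq_rightEdge {k : ℕ} {y : ℝ} (h₁ : y ≠ bumpLo k) (h₂ : y ≠ bumpHi k) :
    leftEdge k y = rightEdge k y := by
  unfold leftEdge rightEdge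
  have : y ∈ Icc (bumpLo k) (bumpHi k) ↔ y ∈ Ioo (bumpLo k) (bumpHi k) := by
    simp only [mem_Icc, mem_Ioo]
    exact ⟨fun h => ⟨lt_of_le_of_ne h.1 h₁.symm, lt_of_le_of_ne h.2 h₂⟩,
      fun h => ⟨h.1.le, h.2.le⟩⟩
  simp only [this]

theorem rightEdge_eq_or (k : ℕ) (y : ℝ) : rightEdge k y = -(1 / 2) ∨ rightEdge k y = 0 := by
  unfold rightEdge; split_ifs <;> simp

theorem leftEdge_zero {y : ℝ} (hy : y ≤ 1) : leftEdge 0 y = 0 := by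
  unfold leftEdge
  rw [if_neg]
  intro h
  linarith [h.1, one_lt_bumpLo_zero]

theorem rightEdge_zero {y : ℝ} (hy : y ≤ 1) : rightEdge 0 y = 0 :=
  le_antisymm (rightEdge_nonpos _ _) ((leftEdge_zero hy).symm.trans_le (leftEdge_le_rightEdge _ _))

/-- At height `3 / 4` there is no bump. -/
theorem leftEdge_three_quarters (k : ℕ) : leftEdge k (3 / 4) = 0 := by
  rcases eq_or_ne k 0 with rfl | hk
  · exact leftEdge_zero (by norm_num)
  · unfold leftEdge
    rw [if_neg]
    intro h
    linarith [h.2, bumpHi_lt hk]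

theorem rightEdge_three_quarters (k : ℕ) : rightEdge k (3 / 4) = 0 :=
  le_antisymm (rightEdge_nonpos _ _)
    ((leftEdge_three_quarters k).symm.trans_le (leftEdge_le_rightEdge _ _))

/-- The bump of curve `j` spans the heights from 1/(2j + 1/2) to 1/(2j + 1/3), and the test height
is 1/(2i + 2/5). Cleared of denominators, membership is a pair of integer inequalities that force `i
= j`. This height tells curve `i` from all others. -/
theorem mediant_mem_bump_iff {i j : ℕ} :
    5 / (10 * (i : ℝ) + 2) ∈ Icc (bumpLo j) (bumpHi j) ↔ i = j := by
  unfold bumpLo bumpHi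
  rw [mem_Icc, div_le_div_iff₀ (by positivity) (by positivity),
    div_le_div_iff₀ (by positivity) (by positivity)]
  constructor
  · rintro ⟨h₁, h₂⟩
    norm_cast at h₁ h₂
    omega
  · rintro rfl
    constructor <;> linarith

theorem mediant_mem_Ioo_bump (i : ℕ) :
    5 / (10 * (i : ℝ) + 2) ∈ Ioo (bumpLo i) (bumpHi i) := by
  unfold bumpLo bumpHi
  rw [mem_Ioo, div_lt_div_iff₀ (by positivity) (by positivity),
    div_lt_div_iff₀ (by positivity) (by positivity)]
  constructor <;> linarith

theorem mediant_mem_Icc_zero_one {i : ℕ} (hi : i ≠ 0) :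
    5 / (10 * (i : ℝ) + 2) ∈ Icc (0 : ℝ) 1 := by
  have h := mediant_mem_Ioo_bump i
  exact ⟨(bumpLo_pos i).le.trans h.1.le, by linarith [h.2, bumpHi_lt hi]⟩

/-- Distinct curves differ inside the strip. -/
theorem leftEdge_injective {i j : ℕ} (h : ∀ y ∈ Icc (0 : ℝ) 1, leftEdge i y = leftEdge j y) :
    i = j := by
  wlog hi : i ≠ 0 generalizing i j
  · by_contra hij
    exact hij (this (fun y hy => (h y hy).symm) (by grind)).symm
  have h' := h _ (mediant_mem_Icc_zero_one hi)
  unfold leftEdge at h'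
  rw [if_pos (mediant_mem_bump_iff.2 rfl)] at h'
  split_ifs at h' with hj
  · exact mediant_mem_bump_iff.1 hj
  · norm_num at h'

theorem rightEdge_injective {i j : ℕ}
    (h : ∀ y ∈ Icc (0 : ℝ) 1, rightEdge i y = rightEdge j y) : i = j := by
  wlog hi : i ≠ 0 generalizing i j
  · by_contra hij
    exact hij (this (fun y hy => (h y hy).symm) (by grind)).symm
  have h' := h _ (mediant_mem_Icc_zero_one hi)
  unfold rightEdge at h'
  rw [if_pos (mediant_mem_Ioo_bump i)] at h'
  split_ifs at h' with hj
  · exact mediant_mem_bump_iff.1 (Ioo_subset_Icc_self hj)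
  · norm_num at h'

/-! ### Topology of the shapes -/

theorem isOpen_rightEdge_lt (k : ℕ) (s : ℝ) :
    IsOpen {p : ℝ × ℝ | s + rightEdge k p.2 < p.1} := by
  have : {p : ℝ × ℝ | s + rightEdge k p.2 < p.1} = {p | s < p.1} ∪
      ({p | s - 1 / 2 < p.1} ∩ ({p | bumpLo k < p.2} ∩ {p | p.2 < bumpHi k})) := by
    ext p
    simp only [rightEdge, mem_ofPred_eq, mem_union, mem_inter_iff, mem_Ioo]
    grind
  rw [this]
  refine (isOpen_lt ?_ ?_).union ((isOpen_lt ?_ ?_).inter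
    ((isOpen_lt ?_ ?_).inter (isOpen_lt ?_ ?_))) <;> fun_prop

theorem isOpen_lt_leftEdge (k : ℕ) (t : ℝ) :
    IsOpen {p : ℝ × ℝ | p.1 < t + leftEdge k p.2} := by
  have : {p : ℝ × ℝ | p.1 < t + leftEdge k p.2} = {p | p.1 < t - 1 / 2} ∪
      ({p | p.1 < t} ∩ ({p | p.2 < bumpLo k} ∪ {p | bumpHi k < p.2})) := by
    ext p
    simp only [leftEdge, mem_ofPred_eq, mem_union, mem_inter_iff, mem_Icc]
    grind
  rw [this]
  refine (isOpen_lt ?_ ?_).union ((isOpen_lt ?_ ?_).inter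
    ((isOpen_lt ?_ ?_).union (isOpen_lt ?_ ?_))) <;> fun_prop

theorem isClosed_leftEdge_le (k : ℕ) (s : ℝ) :
    IsClosed {p : ℝ × ℝ | s + leftEdge k p.2 ≤ p.1} := by
  simpa [compl_ofPred] using (isOpen_lt_leftEdge k s).isClosed_compl

theorem isClosed_le_rightEdge (k : ℕ) (t : ℝ) :
    IsClosed {p : ℝ × ℝ | p.1 ≤ t + rightEdge k p.2} := by
  simpa [compl_ofPred] using (isOpen_rightEdge_lt k t).isClosed_compl

theorem isClosed_shape (i : ℕ) (s : ℝ) (j : ℕ) (t : ℝ) : IsClosed (shape i s j t) :=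
  (isClosed_Icc.preimage continuous_snd).inter
    ((isClosed_leftEdge_le i s).inter (isClosed_le_rightEdge j t))

theorem isOpen_openShape (i : ℕ) (s : ℝ) (j : ℕ) (t : ℝ) : IsOpen (openShape i s j t) :=
  (isOpen_Ioo.preimage continuous_snd).inter
    ((isOpen_rightEdge_lt i s).inter (isOpen_lt_leftEdge j t))

theorem openShape_subset_shape (i : ℕ) (s : ℝ) (j : ℕ) (t : ℝ) :
    openShape i s j t ⊆ shape i s j t := fun p hp =>
  ⟨Ioo_subset_Icc_self hp.1, by linarith [hp.2.1, leftEdge_le_rightEdge i p.2],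
    by linarith [hp.2.2, leftEdge_le_rightEdge j p.2]⟩

theorem openShape_subset_interior (i : ℕ) (s : ℝ) (j : ℕ) (t : ℝ) :
    openShape i s j t ⊆ interior (shape i s j t) :=
  interior_maximal (openShape_subset_shape i s j t) (isOpen_openShape i s j t)

/-- A shape is a finite union of nondegenerate rectangles. -/
theorem exists_rectangles_shape {i j : ℕ} {s t : ℝ} (hst : s < t) (hj : j ≠ 0 → s + 1 / 2 < t) :
    ∃ B : Finset ((ℝ × ℝ) × (ℝ × ℝ)),
      (∀ r ∈ B, r.1.1 < r.2.1 ∧ r.1.2 < r.2.2) ∧ shape i s j t = ⋃ r ∈ B, Icc r.1 r.2 := by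
  classical
  refine ⟨(if j = 0 then {((s, 0), (t, 1))} else {((s, 0), (t - 1 / 2, 1)),
      ((s, 0), (t, bumpLo j)), ((s, bumpHi j), (t, 1))}) ∪
      (if i = 0 then ∅ else {((s - 1 / 2, bumpLo i), (s, bumpHi i))}), ?_, ?_⟩
  · intro r hr
    have h₁ := bumpLo_lt_bumpHi i
    have h₂ := bumpLo_pos j
    have h₃ := @bumpHi_lt j
    simp only [Finset.mem_union] at hr
    rcases hr with hr | hr
    · split_ifs at hr with h
      · simp only [Finset.mem_singleton] at hr
        subst hr
        exact ⟨hst, one_pos⟩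
      · simp only [Finset.mem_insert, Finset.mem_singleton] at hr
        have := h₃ h
        have := hj h
        rcases hr with rfl | rfl | rfl <;> constructor <;> dsimp only <;> linarith
    · split_ifs at hr with h
      · simp at hr
      · simp only [Finset.mem_singleton] at hr
        subst hr
        constructor <;> dsimp only <;> linarith
  · have hi₁ := bumpLo_lt_bumpHi i
    have hi₂ := bumpLo_pos i
    have hi₃ := @bumpHi_lt i
    have hj₁ := bumpLo_lt_bumpHi j
    have hj₂ := bumpLo_pos j
    have hj₃ := @bumpHi_lt j
    have h0 := one_lt_bumpLo_zero
    ext ⟨x, y⟩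
    by_cases hj0 : j = 0 <;> by_cases hi0 : i = 0 <;>
      simp only [hj0, hi0, if_true, if_false, Finset.union_empty, Finset.mem_singleton,
        Finset.mem_union, Finset.mem_insert, mem_iUnion, exists_prop, or_and_right, exists_or,
        exists_eq_left, Prod.mk_le_mk, mem_Icc, shape, leftEdge, rightEdge, mem_ofPred_eq,
        mem_Ioo] <;> grind

/-- A shape is the closure of its interior. -/
theorem shape_subset_closure_interior {i j : ℕ} {s t : ℝ} (hst : s < t)
    (hj : j ≠ 0 → s + 1 / 2 < t) : shape i s j t ⊆ closure (interior (shape i s j t)) := by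
  obtain ⟨B, hB, hS⟩ := exists_rectangles_shape (i := i) hst hj
  intro p hp
  have hp' := hp
  rw [hS] at hp'
  simp only [mem_iUnion, exists_prop] at hp'
  obtain ⟨r, hr, hpr⟩ := hp'
  have hsub : Ioo r.1.1 r.2.1 ×ˢ Ioo r.1.2 r.2.2 ⊆ interior (shape i s j t) := by
    refine interior_maximal ?_ (isOpen_Ioo.prod isOpen_Ioo)
    rw [hS]
    intro z hz
    simp only [mem_iUnion, exists_prop]
    exact ⟨r, hr, ⟨hz.1.1.le, hz.2.1.le⟩, ⟨hz.1.2.le, hz.2.2.le⟩⟩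
  refine closure_mono hsub ?_
  rw [closure_prod_eq, closure_Ioo (hB r hr).1.ne, closure_Ioo (hB r hr).2.ne]
  exact ⟨⟨hpr.1.1, hpr.2.1⟩, ⟨hpr.1.2, hpr.2.2⟩⟩

/-- Left and right edges differ only at the ends of bumps. Density lets arguments about open or
closed sets avoid these heights and finitely many vertical lines. -/
theorem dense_compl_prod_compl {F G : Set ℝ} (hF : F.Finite) (hG : G.Finite) :
    Dense (Fᶜ ×ˢ Gᶜ : Set (ℝ × ℝ)) :=
  (hF.countable.dense_compl ℝ).prod (hG.countable.dense_compl ℝ)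

/-- A shape lies in a closed set if its generic interior points do. -/
theorem shape_subset_of_generic {i j : ℕ} {s t : ℝ} (hst : s < t) (hj : j ≠ 0 → s + 1 / 2 < t)
    {F G : Set ℝ} (hF : F.Finite) (hG : G.Finite) {Z : Set (ℝ × ℝ)} (hZ : IsClosed Z)
    (h : ∀ p ∈ interior (shape i s j t), p.1 ∉ F → p.2 ∉ G → p ∈ Z) : shape i s j t ⊆ Z := by
  refine (shape_subset_closure_interior hst hj).trans
    (closure_minimal (((dense_compl_prod_compl hF hG).open_subset_closure_inter
      isOpen_interior).trans (closure_minimal ?_ hZ)) hZ)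
  rintro p ⟨hp, hp'⟩
  exact h p hp hp'.1 hp'.2

/-- The shapes on both sides of a curve do not overlap. -/
theorem disjoint_interior_of_edge {j : ℕ} {u : ℝ} {A B : Set (ℝ × ℝ)}
    (hA : ∀ p ∈ A, p.1 ≤ u + rightEdge j p.2) (hB : ∀ p ∈ B, u + leftEdge j p.2 ≤ p.1) :
    Disjoint (interior A) (interior B) := by
  rw [← not_nonempty_iff_eq_empty.trans disjoint_iff_inter_eq_empty.symm]
  intro hne
  obtain ⟨p, hp, hp'⟩ := (dense_compl_prod_compl (F := {u, u - 1 / 2})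
    (G := {bumpLo j, bumpHi j}) (by simp) (by simp)).inter_open_nonempty _
    (isOpen_interior.inter isOpen_interior) hne
  have h₁ := hA p (interior_subset hp.1)
  have h₂ := hB p (interior_subset hp.2)
  simp only [mem_prod, mem_compl_iff, mem_insert_iff, mem_singleton_iff, not_or] at hp'
  rw [leftEdge_eq_rightEdge hp'.2.1 hp'.2.2] at h₂
  rcases rightEdge_eq_or j p.2 with h | h <;> rw [h] at h₁ h₂
  · exact hp'.1.2 (by linarith)
  · exact hp'.1.1 (by linarith)

/-! ### Shapes are tall tiles -/

/-- A set is contractible if it can be pushed horizontally to a vertical segment inside it. -/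
theorem contractibleSpace_of_horizontal {S : Set (ℝ × ℝ)} {c : ℝ} {I : Set ℝ} (hI : Convex ℝ I)
    (hne : I.Nonempty) (hSI : ∀ p ∈ S, p.2 ∈ I) (hc : ∀ y ∈ I, (c, y) ∈ S)
    (hS : ∀ p ∈ S, ∀ r ∈ Icc (0 : ℝ) 1, ((1 - r) * p.1 + r * c, p.2) ∈ S) :
    ContractibleSpace S := by
  obtain ⟨b, hb⟩ := hne
  rw [contractible_iff_id_nullhomotopic]
  let m : C(S, S) := ⟨fun p => ⟨(c, p.1.2), hc _ (hSI _ p.2)⟩, by fun_prop⟩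
  have h₁ : (ContinuousMap.id S).Homotopic m :=
    ⟨{  toFun := fun q => ⟨((1 - (q.1 : ℝ)) * q.2.1.1 + q.1 * c, q.2.1.2), hS _ q.2.2 _ q.1.2⟩
        continuous_toFun := by fun_prop
        map_zero_left := fun p => by ext <;> simp
        map_one_left := fun p => by ext <;> simp [m] }⟩
  have h₂ : m.Homotopic (ContinuousMap.const S ⟨(c, b), hc b hb⟩) :=
    ⟨{  toFun := fun q => ⟨(c, (1 - (q.1 : ℝ)) * q.2.1.2 + q.1 * b), hc _
          (hI (hSI _ q.2.2) hb (by linarith [q.1.2.2]) q.1.2.1 (by ring))⟩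
        continuous_toFun := by fun_prop
        map_zero_left := fun p => by ext <;> simp [m]
        map_one_left := fun p => by ext <;> simp }⟩
  exact ⟨_, h₁.trans h₂⟩

/-- The segment at abscissa 1/4 meets no bump, since the right edge stays at or beyond t - 1/2 ≥
1/2. Every point joins it horizontally. -/
theorem isPreconnected_openShape {i j : ℕ} {t : ℝ} (ht : 1 ≤ t) :
    IsPreconnected (openShape i 0 j t) := by
  have hcore : ∀ y ∈ Ioo (0 : ℝ) 1, ((1 / 4 : ℝ), y) ∈ openShape i 0 j t := fun y hy =>
    ⟨hy, by linarith [rightEdge_nonpos i y], by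
      have := neg_half_le_leftEdge j y
      dsimp only
      linarith⟩
  refine isPreconnected_of_forall (1 / 4, 1 / 2) fun p hp => ?_
  refine ⟨(fun x => (x, p.2)) '' uIcc (1 / 4) p.1 ∪ (fun y => ((1 / 4 : ℝ), y)) '' Ioo 0 1,
    ?_, Or.inr ⟨1 / 2, by norm_num, rfl⟩, Or.inl ⟨p.1, right_mem_uIcc, rfl⟩, ?_⟩
  · rintro _ (⟨x, hx, rfl⟩ | ⟨y, hy, rfl⟩)
    · have h₁ := hp.2.1
      have h₂ := hp.2.2
      have h₃ := rightEdge_nonpos i p.2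
      have h₄ := neg_half_le_leftEdge j p.2
      refine ⟨hp.1, ?_, ?_⟩ <;> dsimp only <;>
        rcases mem_uIcc.1 hx with hx | hx <;> linarith [hx.1, hx.2]
    · exact hcore y hy
  · refine IsPreconnected.union (1 / 4, p.2) ⟨1 / 4, left_mem_uIcc, rfl⟩ ⟨p.2, hp.1, rfl⟩ ?_ ?_
    · exact isPreconnected_uIcc.image _ (by fun_prop)
    · exact isPreconnected_Ioo.image _ (by fun_prop)

theorem shape_subset_closure_openShape {i j : ℕ} {s t : ℝ} (hst : s < t)
    (hj : j ≠ 0 → s + 1 / 2 < t) : shape i s j t ⊆ closure (openShape i s j t) := by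
  refine shape_subset_of_generic hst hj (F := {s, s - 1 / 2, t, t - 1 / 2})
    (G := {0, 1, bumpLo i, bumpHi i, bumpLo j, bumpHi j}) (by simp) (by simp)
    isClosed_closure fun p hp hF hG => subset_closure ?_
  simp only [mem_insert_iff, mem_singleton_iff, not_or] at hF hG
  obtain ⟨h₁, h₂, h₃⟩ := interior_subset hp
  have ei := leftEdge_eq_rightEdge hG.2.2.1 hG.2.2.2.1
  have ej := leftEdge_eq_rightEdge hG.2.2.2.2.1 hG.2.2.2.2.2
  refine ⟨⟨lt_of_le_of_ne h₁.1 (Ne.symm hG.1), lt_of_le_of_ne h₁.2 hG.2.1⟩, ?_, ?_⟩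
  · rw [← ei]
    refine lt_of_le_of_ne h₂ ?_
    rcases rightEdge_eq_or i p.2 with h | h <;> rw [ei, h] <;> grind
  · rw [ej]
    refine lt_of_le_of_ne h₃ ?_
    rcases rightEdge_eq_or j p.2 with h | h <;> rw [h] <;> grind

theorem core_mem_shape {i j : ℕ} {t y : ℝ} (ht : 1 ≤ t) (hy : y ∈ Icc (0 : ℝ) 1) :
    ((1 / 4 : ℝ), y) ∈ shape i 0 j t :=
  ⟨hy, by linarith [leftEdge_nonpos i y], by
    have := neg_half_le_rightEdge j y
    dsimp only
    linarith⟩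

theorem isTallTile_shape {i j : ℕ} {t : ℝ} (ht : 1 ≤ t) : IsTallTile (shape i 0 j t) := by
  have h0 : 0 < t := by linarith
  have hj : j ≠ 0 → 0 + 1 / 2 < t := fun _ => by linarith
  have hcore : ∀ y ∈ Icc (0 : ℝ) 1, ((1 / 4 : ℝ), y) ∈ shape i 0 j t := fun y hy =>
    core_mem_shape ht hy
  refine ⟨⟨exists_rectangles_shape h0 hj, ⟨⟨(1 / 4, 3 / 4), ?_⟩, ?_⟩, ?_⟩, 0, ?_⟩
  · refine openShape_subset_interior _ _ _ _ ⟨by norm_num, ?_, ?_⟩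
    · norm_num [rightEdge_three_quarters]
    · norm_num [leftEdge_three_quarters]
      linarith
  · exact (isPreconnected_openShape ht).subset_closure (openShape_subset_interior _ _ _ _)
      (interior_subset.trans (shape_subset_closure_openShape h0 hj))
  · have : ContractibleSpace (shape i 0 j t) := by
      refine contractibleSpace_of_horizontal (c := 1 / 4) (convex_Icc 0 1) ⟨0, by simp⟩
        (fun p hp => hp.1) hcore fun p hp r hr => ⟨hp.1, ?_, ?_⟩
      · have := leftEdge_nonpos i p.2
        have h := hp.2.1
        dsimp only
        nlinarith [hr.1, hr.2]
      · have := neg_half_le_rightEdge j p.2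
        have h := hp.2.2
        dsimp only
        nlinarith [hr.1, hr.2]
    exact SimplyConnectedSpace.ofContractible _
  · rw [zero_add]
    ext y
    exact ⟨by rintro ⟨p, hp, rfl⟩; exact hp.1, fun hy => ⟨_, hcore y hy, rfl⟩⟩

/-! ### Tiles and their positions -/

/-- A translate of a tile that lies in the strip is a horizontal translate. -/
theorem translate_shape {i j : ℕ} {t : ℝ} (ht : 1 ≤ t) {v : ℝ × ℝ}
    (hv : ∀ p ∈ (fun p => v + p) '' shape i 0 j t, p.2 ∈ Icc (0 : ℝ) 1) :
    (fun p => v + p) '' shape i 0 j t = shape i v.1 j (v.1 + t) := by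
  have hcore : ∀ y ∈ Icc (0 : ℝ) 1, ((1 / 4 : ℝ), y) ∈ shape i 0 j t := fun y hy =>
    core_mem_shape ht hy
  -- The tile contains a vertical segment of full height 1, which leaves no room for a vertical
  -- shift.
  have h₀ := (hv _ ⟨_, hcore 0 (by simp), rfl⟩).1
  have h₁ := (hv _ ⟨_, hcore 1 (by simp), rfl⟩).2
  have hv2 : v.2 = 0 := by
    simp only [Prod.snd_add] at h₀ h₁
    linarith
  ext p
  constructor
  · rintro ⟨q, hq, rfl⟩
    obtain ⟨a, b, c⟩ := hq
    refine ⟨?_, ?_, ?_⟩ <;> simp only [Prod.snd_add, Prod.fst_add, hv2, zero_add]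
    · exact a
    · linarith
    · linarith
  · rintro ⟨a, b, c⟩
    refine ⟨(p.1 - v.1, p.2), ⟨a, ?_, ?_⟩, ?_⟩
    · dsimp only; linarith
    · dsimp only; linarith
    · ext <;> simp [hv2]

theorem rectangle_eq_shape {a : ℝ} (ha : 0 < a) : rectangle a = shape 0 0 0 a := by
  rw [rectangle, closure_prod_eq, closure_Ioo ha.ne, closure_Ioo zero_ne_one]
  ext p
  constructor
  · rintro ⟨h₁, h₂⟩
    exact ⟨h₂, by simpa [leftEdge_zero h₂.2] using h₁.1, by simpa [rightEdge_zero h₂.2] using h₁.2⟩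
  · rintro ⟨h₂, h, h'⟩
    rw [leftEdge_zero h₂.2] at h
    rw [rightEdge_zero h₂.2] at h'
    exact ⟨⟨by linarith, by linarith⟩, h₂⟩

/-- The width of the tiles whose left boundary is the `i`-th curve. -/
noncomputable def width (i : ℕ) : ℝ := if i = 0 then √2 else 1

theorem one_le_width (i : ℕ) : 1 ≤ width i := by
  unfold width
  split_ifs
  · rw [Real.one_le_sqrt]; norm_num
  · rfl

/-- The tiles with the `i`-th curve on the left and the `j`-th curve on the right, where
`j ∈ next i`. -/
def tileSet (next : ℕ → Finset ℕ) : Set (Set (ℝ × ℝ)) :=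
  {τ | ∃ i, ∃ j ∈ next i, τ = shape i 0 j (width i)}

theorem left_mem_shape {i j : ℕ} {s t y : ℝ} (hst : s + 1 ≤ t) (hy : y ∈ Icc (0 : ℝ) 1) :
    (s + leftEdge i y, y) ∈ shape i s j t :=
  ⟨hy, le_rfl, by
    dsimp only
    linarith [leftEdge_nonpos i y, neg_half_le_rightEdge j y]⟩

theorem right_mem_shape {i j : ℕ} {s t y : ℝ} (hst : s + 1 ≤ t) (hy : y ∈ Icc (0 : ℝ) 1) :
    (t + rightEdge j y, y) ∈ shape i s j t :=
  ⟨hy, by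
    dsimp only
    linarith [leftEdge_nonpos i y, neg_half_le_rightEdge j y], le_rfl⟩

theorem three_quarters_mem : (3 / 4 : ℝ) ∈ Icc (0 : ℝ) 1 := by norm_num

/-- At height 3/4 no curve has a bump, so the edges there give the positions; the other heights then
identify the curves. -/
theorem shape_injective {i i' j j' : ℕ} {s s' t t' : ℝ} (hst : s + 1 ≤ t) (hst' : s' + 1 ≤ t')
    (h : shape i s j t = shape i' s' j' t') : i = i' ∧ s = s' ∧ j = j' ∧ t = t' := by
  have hl : ∀ y ∈ Icc (0 : ℝ) 1, s + leftEdge i y = s' + leftEdge i' y := fun y hy =>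
    le_antisymm (h.symm.subset (left_mem_shape hst' hy)).2.1 (h.subset (left_mem_shape hst hy)).2.1
  have hr : ∀ y ∈ Icc (0 : ℝ) 1, t + rightEdge j y = t' + rightEdge j' y := fun y hy =>
    le_antisymm (h.subset (right_mem_shape hst hy)).2.2 (h.symm.subset (right_mem_shape hst' hy)).2.2
  have hs : s = s' := by
    simpa [leftEdge_three_quarters] using hl _ three_quarters_mem
  have ht : t = t' := by
    simpa [rightEdge_three_quarters] using hr _ three_quarters_mem
  subst hs ht
  exact ⟨leftEdge_injective fun y hy => by linarith [hl y hy], rfl,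
    rightEdge_injective fun y hy => by linarith [hr y hy], rfl⟩

/-- Two tiles without overlap can be ordered from left to right. -/
theorem le_or_le_of_disjoint {i i' j j' : ℕ} {s s' t t' : ℝ} (hst : s < t) (hst' : s' < t')
    (h : Disjoint (interior (shape i s j t)) (interior (shape i' s' j' t'))) :
    t ≤ s' ∨ t' ≤ s := by
  by_contra! hc
  obtain ⟨x, hx₁, hx₂⟩ := exists_between
    (max_lt (lt_min hst hc.2) (lt_min hc.1 hst') : max s s' < min t t')
  rw [max_lt_iff] at hx₁
  rw [lt_min_iff] at hx₂
  refine not_disjoint_iff.2 ⟨(x, 3 / 4), openShape_subset_interior _ _ _ _ ?_,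
    openShape_subset_interior _ _ _ _ ?_⟩ h
  all_goals
    refine ⟨by norm_num, ?_, ?_⟩ <;>
    simp [leftEdge_three_quarters, rightEdge_three_quarters, hx₁, hx₂]

/-- If of two tiles without overlap one is on the left of the other at some height, then it is so
at every height. -/
theorem edge_le_edge_of_disjoint {i i' j j' : ℕ} {s s' t t' : ℝ} (hst : s + 1 ≤ t)
    (hst' : s' + 1 ≤ t') (hts : t ≤ s')
    (h : Disjoint (interior (shape i s j t)) (interior (shape i' s' j' t')))
    {y : ℝ} (hy : y ∈ Ioo (0 : ℝ) 1) : t + leftEdge j y ≤ s' + rightEdge i' y := by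
  by_contra! hc
  have h₁ := rightEdge_nonpos i y
  have h₂ := rightEdge_nonpos i' y
  have h₃ := neg_half_le_leftEdge j y
  have h₄ := neg_half_le_leftEdge j' y
  obtain ⟨x, hx₁, hx₂⟩ := exists_between
    (max_lt (lt_min (by linarith) (by linarith)) (lt_min hc (by linarith)) :
      max (s + rightEdge i y) (s' + rightEdge i' y) <
        min (t + leftEdge j y) (t' + leftEdge j' y))
  rw [max_lt_iff] at hx₁
  rw [lt_min_iff] at hx₂
  exact not_disjoint_iff.2 ⟨(x, y),
    openShape_subset_interior _ _ _ _ ⟨hy, hx₁.1, hx₂.1⟩,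
    openShape_subset_interior _ _ _ _ ⟨hy, hx₁.2, hx₂.2⟩⟩ h

theorem shape_eq_translate (i j : ℕ) (s : ℝ) :
    shape i s j (s + width i) = (fun p => ((s, 0) : ℝ × ℝ) + p) '' shape i 0 j (width i) := by
  refine (translate_shape (one_le_width i) (v := (s, 0)) ?_).symm
  rintro _ ⟨p, hp, rfl⟩
  simpa using hp.1

/-! ### Peeling off the first tile -/

section Recursion

variable {next : ℕ → Finset ℕ} {q j : ℕ} {s a : ℝ} {C : Set (Set (ℝ × ℝ))}

theorem IsTiling.subset {T : Set (Set (ℝ × ℝ))} {Γ : Set (ℝ × ℝ)} (hC : IsTiling T Γ C)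
    {σ : Set (ℝ × ℝ)} (hσ : σ ∈ C) : σ ⊆ Γ :=
  (subset_sUnion_of_mem hσ).trans hC.covers.subset

theorem IsTiling.exists_eq_shape (hC : IsTiling (tileSet next) (shape q s 0 a) C)
    {σ : Set (ℝ × ℝ)} (hσ : σ ∈ C) :
    ∃ i, ∃ j ∈ next i, ∃ u, σ = shape i u j (u + width i) ∧ s ≤ u ∧ u + width i ≤ a := by
  obtain ⟨_, ⟨i, j, hj, rfl⟩, v, rfl⟩ := hC.translate σ hσ
  have hsub := hC.subset hσ
  have he := translate_shape (one_le_width i) (v := v) fun p hp => (hsub hp).1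
  rw [he] at hsub
  have hw : v.1 + 1 ≤ v.1 + width i := by linarith [one_le_width i]
  refine ⟨i, j, hj, v.1, he, ?_, ?_⟩
  · simpa [leftEdge_three_quarters] using
      (hsub (left_mem_shape (j := j) hw three_quarters_mem)).2.1
  · simpa [rightEdge_three_quarters] using
      (hsub (right_mem_shape (i := i) hw three_quarters_mem)).2.2

/-- Widths are at least 1, so distinct tiles have positions with distinct integer parts. Finiteness
makes unions of tiles closed in `IsTiling.diff_first`. -/
theorem IsTiling.finite (hC : IsTiling (tileSet next) (shape q s 0 a) C) : C.Finite := by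
  choose! i j _ u hu hsu hua using fun σ (hσ : σ ∈ C) => hC.exists_eq_shape hσ
  refine Set.Finite.of_injOn (f := fun σ => ⌊u σ⌋) (t := Icc ⌊s⌋ ⌊a⌋) ?_ ?_ (finite_Icc _ _)
  · intro σ hσ
    exact ⟨Int.floor_le_floor (hsu σ hσ),
      Int.floor_le_floor (by linarith [hua σ hσ, one_le_width (i σ)])⟩
  · intro σ hσ σ' hσ' he
    by_contra hne
    have hd := hC.nonoverlapping σ hσ σ' hσ' hne
    rw [hu σ hσ, hu σ' hσ'] at hd
    have h₁ := one_le_width (i σ)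
    have h₂ := one_le_width (i σ')
    have h₃ := Int.abs_sub_lt_one_of_floor_eq_floor he
    rw [abs_lt] at h₃
    rcases le_or_le_of_disjoint (by linarith) (by linarith) hd with h | h <;> linarith [h₃.1, h₃.2]

/-- In a tiling of the region on the right of a curve, some tile has this curve as its left
boundary. -/
theorem IsTiling.exists_first (hs : s < a) (hC : IsTiling (tileSet next) (shape q s 0 a) C) :
    ∃ j ∈ next q, shape q s j (s + width q) ∈ C := by
  have key : ∀ y ∈ Icc (0 : ℝ) 1, ∃ i, ∃ j ∈ next i, ∃ u, shape i u j (u + width i) ∈ C ∧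
      u + leftEdge i y = s + leftEdge q y ∧ s ≤ u := by
    intro y hy
    have hp : (s + leftEdge q y, y) ∈ shape q s 0 a := by
      refine ⟨hy, le_rfl, ?_⟩
      rw [rightEdge_zero hy.2]
      linarith [leftEdge_nonpos q y]
    rw [← hC.covers] at hp
    obtain ⟨σ, hσ, hpσ⟩ := hp
    obtain ⟨i, j, hj, u, rfl, hu, -⟩ := hC.exists_eq_shape hσ
    exact ⟨i, j, hj, u, hσ, le_antisymm hpσ.2.1 (hC.subset hσ (left_mem_shape
      (by linarith [one_le_width i]) hy)).2.1, hu⟩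
  obtain ⟨i, j, hj, u, hσ, hu, -⟩ := key _ three_quarters_mem
  have hus : u = s := by simpa [leftEdge_three_quarters] using hu
  subst hus
  have hiq : i = q := by
    refine leftEdge_injective fun y hy => ?_
    obtain ⟨i', j', hj', u', hσ', hu', hle⟩ := key y hy
    by_cases he : shape i u j (u + width i) = shape i' u' j' (u' + width i')
    · obtain ⟨rfl, rfl, -, -⟩ := shape_injective (by linarith [one_le_width i])
        (by linarith [one_le_width i']) he
      linarith
    -- A different tile would start at least 1 further right, too far for a bump of depth 1/2 to
    -- reach the left boundary.
    · have h₁ := one_le_width i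
      have h₂ := one_le_width i'
      have h₃ := leftEdge_nonpos q y
      have h₄ := neg_half_le_leftEdge i' y
      rcases le_or_le_of_disjoint (by linarith) (by linarith)
        (hC.nonoverlapping _ hσ _ hσ' he) with h | h <;> linarith
  subst hiq
  exact ⟨j, hj, hσ⟩

theorem shape_union_shape {u : ℝ} (hs : s + 1 ≤ u) (hu : u ≤ a) :
    shape q s j u ∪ shape j u 0 a = shape q s 0 a := by
  ext p
  have h₁ := leftEdge_nonpos q p.2
  have h₂ := neg_half_le_leftEdge j p.2
  have h₃ := rightEdge_nonpos j p.2
  have h₄ := leftEdge_le_rightEdge j p.2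
  constructor
  · rintro (⟨hp, h, h'⟩ | ⟨hp, h, h'⟩)
    · exact ⟨hp, h, by rw [rightEdge_zero hp.2]; linarith⟩
    · exact ⟨hp, by linarith, h'⟩
  · rintro ⟨hp, h, h'⟩
    rcases le_total p.1 (u + rightEdge j p.2) with hle | hle
    · exact Or.inl ⟨hp, h, hle⟩
    · exact Or.inr ⟨hp, by linarith, h'⟩

/-- Putting a tile in front of a tiling. -/
theorem IsTiling.insert_first (hj : j ∈ next q) (ha : s + width q < a)
    (hC : IsTiling (tileSet next) (shape j (s + width q) 0 a) C) :
    IsTiling (tileSet next) (shape q s 0 a) (insert (shape q s j (s + width q)) C) := by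
  have hd : ∀ σ ∈ C, Disjoint (interior (shape q s j (s + width q))) (interior σ) := fun σ hσ =>
    disjoint_interior_of_edge (fun p hp => hp.2.2) fun p hp => (hC.subset hσ hp).2.1
  refine ⟨?_, ?_, ?_⟩
  · rintro σ (rfl | hσ)
    · exact ⟨_, ⟨q, j, hj, rfl⟩, (s, 0), shape_eq_translate q j s⟩
    · exact hC.translate σ hσ
  · rintro σ (rfl | hσ) σ' (rfl | hσ') hne
    · exact absurd rfl hne
    · exact hd σ' hσ'
    · exact (hd σ hσ).symm
    · exact hC.nonoverlapping σ hσ σ' hσ' hne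
  · rw [sUnion_insert, hC.covers]
    exact shape_union_shape (by linarith [one_le_width q]) ha.le

theorem IsTiling.first_notMem (hC : IsTiling (tileSet next) (shape j (s + width q) 0 a) C) (k : ℕ) :
    shape q s k (s + width q) ∉ C := by
  intro h
  have := (hC.subset h (left_mem_shape (by linarith [one_le_width q]) three_quarters_mem)).2.1
  simp only [leftEdge_three_quarters] at this
  linarith [one_le_width q]

theorem isTiling_singleton (hj : j ∈ next q) {t : ℝ} (ht : s + width q = t) :
    IsTiling (tileSet next) (shape q s j t) {shape q s j t} := by
  subst ht
  refine ⟨?_, ?_, sUnion_singleton _⟩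
  · rintro σ rfl
    exact ⟨_, ⟨q, j, hj, rfl⟩, (s, 0), shape_eq_translate q j s⟩
  · rintro σ rfl σ' rfl hne
    exact absurd rfl hne

/-- Removing the first tile from a tiling. -/
theorem IsTiling.diff_first (hs : s < a) (hC : IsTiling (tileSet next) (shape q s 0 a) C)
    (hσ : shape q s j (s + width q) ∈ C) :
    (C = {shape q s j (s + width q)} ∧ s + width q = a ∧ j = 0) ∨
      (s + width q < a ∧ IsTiling (tileSet next) (shape j (s + width q) 0 a)
        (C \ {shape q s j (s + width q)})) := by
  set t := s + width q with ht
  have hst : s + 1 ≤ t := by linarith [one_le_width q]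
  rcases (C \ {shape q s j t}).eq_empty_or_nonempty with he | hne
  · left
    have hCe : C = {shape q s j t} :=
      (sdiff_eq_empty.1 he).antisymm (singleton_subset_iff.2 hσ)
    have hcov := hC.covers
    rw [hCe, sUnion_singleton] at hcov
    have hta : t ≤ a := by
      simpa [rightEdge_three_quarters] using
        (hcov.subset (right_mem_shape hst three_quarters_mem)).2.2
    have hat : a ≤ t := by
      have hmem : (a, 3 / 4) ∈ shape q s 0 a :=
        ⟨three_quarters_mem, by simpa [leftEdge_three_quarters] using hs.le,
          by simp [rightEdge_three_quarters]⟩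
      simpa [rightEdge_three_quarters] using (hcov.symm.subset hmem).2.2
    have hat' := le_antisymm hta hat
    exact ⟨hCe, hat', (shape_injective hst (hat' ▸ hst) hcov).2.2.1⟩
  · right
    have hright : ∀ σ ∈ C \ {shape q s j t}, ∃ i k u, σ = shape i u k (u + width i) ∧ t ≤ u ∧
        u + width i ≤ a ∧ ∀ y ∈ Ioo (0 : ℝ) 1, t + leftEdge j y ≤ u + rightEdge i y := by
      rintro σ' ⟨hσ', hneq⟩
      obtain ⟨i, k, -, u, rfl, hu, hua⟩ := hC.exists_eq_shape hσ'
      have hd := hC.nonoverlapping _ hσ _ hσ' (Ne.symm hneq)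
      have hi := one_le_width i
      have htu : t ≤ u := by
        rcases le_or_le_of_disjoint (by linarith) (by linarith) hd with h | h
        · exact h
        · linarith
      exact ⟨i, k, u, rfl, htu, hua, fun y hy =>
        edge_le_edge_of_disjoint hst (by linarith) htu hd hy⟩
    have hta : t < a := by
      obtain ⟨σ', hσ'⟩ := hne
      obtain ⟨i, k, u, -, htu, hua, -⟩ := hright σ' hσ'
      linarith [one_le_width i]
    refine ⟨hta, fun σ' h => hC.translate σ' h.1,
      fun σ₁ h₁ σ₂ h₂ => hC.nonoverlapping σ₁ h₁.1 σ₂ h₂.1, Subset.antisymm ?_ ?_⟩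
    · refine sUnion_subset fun σ' hσ' => ?_
      obtain ⟨i, k, u, rfl, htu, hua, hedge⟩ := hright σ' hσ'
      have hi := one_le_width i
      -- Away from the bump ends of curve `i`, its two edges agree, which turns `hedge` into a bound
      -- for the left edge of the tile.
      refine shape_subset_of_generic (by linarith) (fun _ => by linarith) (F := ∅)
        (G := {0, 1, bumpLo i, bumpHi i}) (by simp) (by simp) (isClosed_shape _ _ _ _)
        fun p hp _ hG => ?_
      simp only [mem_insert_iff, mem_singleton_iff, not_or] at hG
      have hp' := interior_subset hp
      have hpΓ := hC.subset hσ'.1 hp'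
      have h₀ := hedge p.2 ⟨lt_of_le_of_ne hp'.1.1 (Ne.symm hG.1), lt_of_le_of_ne hp'.1.2 hG.2.1⟩
      rw [← leftEdge_eq_rightEdge hG.2.2.1 hG.2.2.2] at h₀
      exact ⟨hp'.1, h₀.trans hp'.2.1, hpΓ.2.2⟩
    -- Points of the open shape lie strictly to the right of the first tile, so the other tiles
    -- cover them; closedness extends this to the whole shape.
    · have hclosed : IsClosed (⋃₀ (C \ {shape q s j t})) := by
        rw [sUnion_eq_biUnion]
        refine (hC.finite.subset sdiff_subset).isClosed_biUnion fun σ' hσ' => ?_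
        obtain ⟨i, k, u, rfl, -⟩ := hright σ' hσ'
        exact isClosed_shape _ _ _ _
      refine (shape_subset_closure_openShape hta (fun h => absurd rfl h)).trans
        (closure_minimal (fun p hp => ?_) hclosed)
      have hpΓ : p ∈ shape q s 0 a :=
        (shape_union_shape (j := j) hst hta.le).subset
          (Or.inr (openShape_subset_shape _ _ _ _ hp))
      rw [← hC.covers] at hpΓ
      obtain ⟨σ', hσ', hpσ'⟩ := hpΓ
      refine ⟨σ', ⟨hσ', ?_⟩, hpσ'⟩
      rintro rfl
      exact absurd hpσ'.2.2 (not_le.2 hp.2.1)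

/-- The number of tilings of the region between the `i`-th curve at position `s` and the straight
line at position `a`. -/
noncomputable def tilingCount (next : ℕ → Finset ℕ) (a : ℝ) (i : ℕ) (s : ℝ) : ℕ∞ :=
  {C | IsTiling (tileSet next) (shape i s 0 a) C}.encard

open Classical in
-- Tilings are sorted by the right curve `j` of their first tile. Removing that tile is a bijection
-- onto the tilings of the rest, unless it already reaches `a`, where only the straight curve fits.
theorem tilingCount_eq_sum (hs : s < a) : tilingCount next a q s =
    ∑ j ∈ next q, if s + width q < a then tilingCount next a j (s + width q) else
      if s + width q = a ∧ j = 0 then 1 else 0 := by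
  set t := s + width q with ht
  have hst : s + 1 ≤ t := by linarith [one_le_width q]
  let X : ℕ → Set (Set (Set (ℝ × ℝ))) := fun j =>
    {C | IsTiling (tileSet next) (shape q s 0 a) C ∧ shape q s j t ∈ C}
  have hX : {C | IsTiling (tileSet next) (shape q s 0 a) C} = ⋃ j ∈ (next q : Set ℕ), X j := by
    ext C
    simp only [mem_ofPred_eq, mem_iUnion, exists_prop, X]
    constructor
    · intro hC
      obtain ⟨j, hj, h⟩ := hC.exists_first hs
      exact ⟨j, hj, hC, h⟩
    · rintro ⟨j, -, hC, -⟩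
      exact hC
  have hdisj : (next q : Set ℕ).PairwiseDisjoint X := by
    intro j _ j' _ hne
    refine disjoint_left.2 fun C h h' => ?_
    have hd := h.1.nonoverlapping _ h.2 _ h'.2 fun he =>
      hne (shape_injective hst hst he).2.2.1
    rcases le_or_le_of_disjoint (by linarith) (by linarith) hd with h | h <;> linarith
  rw [tilingCount, hX, (next q).finite_toSet.encard_biUnion hdisj, finsum_mem_coe_finset]
  refine Finset.sum_congr rfl fun j hj => ?_
  split_ifs with h₁ h₂
  · have : X j = insert (shape q s j t) ''
        {C | IsTiling (tileSet next) (shape j t 0 a) C} := by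
      ext C
      constructor
      · rintro ⟨hC, hσ⟩
        rcases hC.diff_first hs hσ with ⟨-, h, -⟩ | ⟨-, h⟩
        · exact absurd h h₁.ne
        · exact ⟨_, h, by simp [insert_eq_of_mem hσ, ← ht]⟩
      · rintro ⟨C', hC', rfl⟩
        exact ⟨IsTiling.insert_first hj h₁ hC', mem_insert _ _⟩
    rw [this, InjOn.encard_image, tilingCount]
    intro C hC C' hC' he
    have h₃ : shape q s j t ∉ C := IsTiling.first_notMem hC j
    have h₄ : shape q s j t ∉ C' := IsTiling.first_notMem hC' j
    rw [← insert_sdiff_self_of_notMem h₃, ← insert_sdiff_self_of_notMem h₄]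
    exact congrArg (· \ {shape q s j t}) he
  · obtain ⟨hta, rfl⟩ := h₂
    have : X 0 = {{shape q s 0 t}} := by
      ext C
      constructor
      · rintro ⟨hC, hσ⟩
        rcases hC.diff_first hs hσ with ⟨h, -, -⟩ | ⟨h, -⟩
        · exact h
        · exact absurd h h₁
      · rintro rfl
        exact ⟨hta ▸ isTiling_singleton hj rfl, mem_singleton _⟩
    rw [this, encard_singleton]
  · rw [encard_eq_zero]
    refine eq_empty_of_forall_notMem fun C hC => ?_
    rcases hC.1.diff_first hs hC.2 with ⟨-, h⟩ | ⟨h, -⟩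
    · exact h₂ h
    · exact h₁ h

end Recursion

/-! ### Irrationality -/

/-- The length is the sum of the widths of the tiles, and a straight left boundary contributes a √2.
Induction on a bound `N` for the length works because each tile uses up at least 1. -/
theorem exists_of_tilingCount_ne_zero {next : ℕ → Finset ℕ} {a : ℝ} (N : ℕ) :
    ∀ {i : ℕ} {s : ℝ}, s < a → a - s ≤ N → tilingCount next a i s ≠ 0 →
      ∃ k m : ℕ, a - s = k * √2 + m ∧ (i = 0 → k ≠ 0) := by
  induction N with
  | zero =>
    intro i s hs hN _
    simp only [Nat.cast_zero] at hN
    linarith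
  | succ N ih =>
    intro i s hs hN h
    rw [tilingCount_eq_sum hs] at h
    obtain ⟨j, -, hj⟩ := Finset.exists_ne_zero_of_sum_ne_zero h
    have key : ∃ k m : ℕ, a - (s + width i) = k * √2 + m := by
      split_ifs at hj with h₁ h₂
      · obtain ⟨k, m, h, -⟩ := ih h₁ (by push_cast at hN; linarith [one_le_width i]) hj
        exact ⟨k, m, h⟩
      · exact ⟨0, 0, by rw [h₂.1]; simp⟩
      · exact absurd rfl hj
    obtain ⟨k, m, h⟩ := key
    unfold width at h
    split_ifs at h with hi
    · exact ⟨k + 1, m, by push_cast; linarith, fun _ => k.succ_ne_zero⟩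
    · exact ⟨k, m + 1, by push_cast; linarith, fun h => absurd h hi⟩

/-- Rectangles of integral length have no tilings, as every tiling of a rectangle uses a tile of
irrational width. -/
theorem tilingCount_zero_eq_zero (next : ℕ → Finset ℕ) (a : ℝ) (n : ℕ) :
    tilingCount next a 0 (a - (n + 1)) = 0 := by
  by_contra h
  obtain ⟨k, m, h, hk⟩ := exists_of_tilingCount_ne_zero (n + 1)
    (by have := n.cast_nonneg (α := ℝ); linarith) (by push_cast; linarith) h
  refine ((irrational_sqrt_two.natCast_mul (hk rfl)).add_natCast m).ne_nat (n + 1) ?_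
  rw [← h]
  push_cast
  ring

/-! ### From linear recurrences to tile sets -/

open Classical in
/-- The successor function on codes of a relation on `Option κ`. -/
noncomputable def successors {κ : Type*} [Fintype κ] [Encodable κ]
    (R : Option κ → Option κ → Prop) (k : ℕ) : Finset ℕ :=
  ({q' | ∃ q, Encodable.encode q = k ∧ R q q'} : Finset (Option κ)).image Encodable.encode

open Classical in
theorem sum_successors {κ : Type*} [Fintype κ] [Encodable κ] (R : Option κ → Option κ → Prop)
    (q : Option κ) (F : ℕ → ℕ∞) :
    ∑ k ∈ successors R (Encodable.encode q), F k = (if R q none then F 0 else 0) +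
      ∑ x : κ, if R q (some x) then F (Encodable.encode (some x)) else 0 := by
  have h : ∀ q', (∃ p, Encodable.encode p = Encodable.encode q ∧ R p q') ↔ R q q' := fun q' =>
    ⟨by rintro ⟨p, hp, h⟩; rwa [← Encodable.encode_injective hp], fun h => ⟨q, rfl, h⟩⟩
  rw [successors, Finset.sum_image fun _ _ _ _ h => Encodable.encode_injective h,
    Finset.sum_filter, Fintype.sum_option]
  simp only [h, Encodable.encode_none]

open Classical in
theorem sum_successors_zero {κ : Type*} [Fintype κ] [Encodable κ]
    (R : Option κ → Option κ → Prop) (F : ℕ → ℕ∞) :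
    ∑ k ∈ successors R 0, F k = (if R none none then F 0 else 0) +
      ∑ x : κ, if R none (some x) then F (Encodable.encode (some x)) else 0 := by
  have h := sum_successors R none F
  rwa [Encodable.encode_none] at h

theorem finite_tileSet_successors {κ : Type*} [Fintype κ] [Encodable κ]
    (R : Option κ → Option κ → Prop) : (tileSet (successors R)).Finite := by
  classical
  refine (Set.finite_range fun x : Option κ × Option κ => shape (Encodable.encode x.1) 0
    (Encodable.encode x.2) (width (Encodable.encode x.1))).subset ?_
  rintro _ ⟨i, j, hj, rfl⟩
  simp only [successors, Finset.mem_image, Finset.mem_filter] at hj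
  obtain ⟨q', ⟨-, q, rfl, -⟩, rfl⟩ := hj
  exact ⟨(q, q'), rfl⟩

/-- A set of tiles has no multiplicities, so a coefficient c is realised by edges to c of the `M`
copies of a state. All copies have the same count, and the sum collapses. -/
theorem sum_fin_lt {ι : Type*} [Fintype ι] {M : ℕ} {c : ι → ℕ} (hc : ∀ i, c i ≤ M)
    (F : ι → ℕ∞) :
    ∑ x : ι × Fin M, (if (x.2 : ℕ) < c x.1 then F x.1 else 0) = ∑ i, (c i : ℕ∞) * F i := by
  rw [Fintype.sum_prod_type]
  refine Finset.sum_congr rfl fun i _ => ?_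
  dsimp only
  rw [← Finset.sum_filter, Finset.sum_const, Fin.card_filter_val_lt, min_eq_right (hc i),
    nsmul_eq_mul]

/-- The states of the automaton are `none` for the straight line and copies `(i, b)` of the
indices `i`. -/
def transition {ι : Type*} {M : ℕ} (u v : ι → ℕ) (A : ι → ι → ℕ) :
    Option (ι × Fin M) → Option (ι × Fin M) → Prop
  | none, none => False
  | none, some x => (x.2 : ℕ) < u x.1
  | some x, none => v x.1 = 1
  | some x, some y => (y.2 : ℕ) < A x.1 y.1

theorem width_zero : width 0 = √2 := if_pos rfl

theorem width_encode_some {κ : Type*} [Encodable κ] (x : κ) :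
    width (Encodable.encode (some x)) = 1 := by
  rw [Encodable.encode_some]
  exact if_neg (Nat.succ_ne_zero _)

/-- With length n + 1 left, n unit tiles follow the recurrence and the last one ends at the straight
line. Only one tile can close a given state, hence `hg₀`. An earlier return to the straight line
contributes 0. -/
theorem tilingCount_eq_of_recurrence {ι : Type*} [Fintype ι] [Encodable ι] {M : ℕ}
    {g : ι → ℕ → ℕ} {u : ι → ℕ} {A : ι → ι → ℕ} (hg₀ : ∀ i, g i 0 ≤ 1)
    (hg : ∀ i n, g i (n + 1) = ∑ j, A i j * g j n) (hA : ∀ i j, A i j ≤ M) (a : ℝ) (n : ℕ) :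
    ∀ x : ι × Fin M, tilingCount (successors (transition (M := M) u (fun i => g i 0) A)) a
      (Encodable.encode (some x)) (a - (n + 1)) = g x.1 n := by
  classical
  induction n with
  | zero =>
    intro x
    have := hg₀ x.1
    rw [tilingCount_eq_sum (by norm_num), width_encode_some, sum_successors]
    simp only [transition, Nat.cast_zero, zero_add, sub_add_cancel, lt_irrefl, if_false,
      true_and, if_true, Encodable.encode_some, Nat.succ_ne_zero, ite_self,
      Finset.sum_const_zero, add_zero]
    split_ifs with h
    · rw [h]; rfl
    · have h0 : g x.1 0 = 0 := by omega
      rw [h0]; rfl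
  | succ n ih =>
    intro x
    have hn : (0 : ℝ) ≤ n := n.cast_nonneg
    have e : a - ((n + 1 : ℕ) + 1) + 1 = a - (n + 1) := by push_cast; ring
    have hlt : a - ((n : ℝ) + 1) < a := by linarith
    rw [tilingCount_eq_sum (by push_cast; linarith), width_encode_some, sum_successors, e]
    simp only [if_pos hlt, tilingCount_zero_eq_zero, ite_self, zero_add, ih, transition]
    rw [sum_fin_lt (c := A x.1) (hA x.1) fun j => (g j n : ℕ∞), hg]
    push_cast
    rfl

/-- A function that is a combination with coefficients in `ℕ` of functions that satisfy a system
of linear recurrences with coefficients in `ℕ` and have initial values `0` or `1` is a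
tile counting function. -/
theorem isTileCountingFunction_of_recurrence {ι : Type*} [Fintype ι] [Encodable ι]
    (g : ι → ℕ → ℕ) (u : ι → ℕ) (A : ι → ι → ℕ) {f : ℕ → ℕ} (hg₀ : ∀ i, g i 0 ≤ 1)
    (hg : ∀ i n, g i (n + 1) = ∑ j, A i j * g j n) (hf : ∀ n, f n = ∑ i, u i * g i n) :
    IsTileCountingFunction f := by
  classical
  obtain ⟨M, hM⟩ : ∃ M, ∀ c ∈ Set.range u ∪ Set.range (fun x : ι × ι => A x.1 x.2), c ≤ M :=
    ((Set.finite_range _).union (Set.finite_range _)).bddAbove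
  have hu : ∀ i, u i ≤ M := fun i => hM _ (Or.inl ⟨i, rfl⟩)
  have hA : ∀ i j, A i j ≤ M := fun i j => hM _ (Or.inr ⟨(i, j), rfl⟩)
  -- Here √2 is the width of the first tile and 1 that of the last.
  refine ⟨1 + √2, by positivity, tileSet (successors (transition (M := M) u (fun i => g i 0) A)),
    finite_tileSet_successors _, ?_, fun n => ?_⟩
  · rintro _ ⟨i, j, -, rfl⟩
    exact isTallTile_shape (one_le_width i)
  · have ha : (0 : ℝ) < n + (1 + √2) := by positivity
    rw [rectangle_eq_shape ha]
    change tilingCount _ _ 0 0 = _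
    have e : 0 + √2 = ((n : ℝ) + (1 + √2)) - (n + 1) := by ring
    have hlt : ((n : ℝ) + (1 + √2)) - (n + 1) < n + (1 + √2) := by
      have hn : (0 : ℝ) ≤ n := n.cast_nonneg
      linarith
    rw [tilingCount_eq_sum ha, width_zero, sum_successors_zero, e]
    simp only [if_pos hlt, tilingCount_eq_of_recurrence hg₀ hg hA, transition, if_false, zero_add]
    rw [sum_fin_lt hu fun j => (g j n : ℕ∞), hf]
    push_cast
    rfl

/-! ### The five families -/

/-- The indicators of the points 0, …, K are permuted by the shift, except that the indicator of 0
becomes zero; `f` is their combination. -/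
theorem isTileCountingFunction_of_finite_support {f : ℕ → ℕ} (hf : (Function.support f).Finite) :
    IsTileCountingFunction f := by
  obtain ⟨K, hK⟩ := hf.bddAbove
  have hK' : ∀ n, K + 1 ≤ n → f n = 0 := fun n hn => by
    by_contra h
    exact absurd (hK h) (by omega)
  refine isTileCountingFunction_of_recurrence (ι := Fin (K + 1))
    (fun i n => if n = i then 1 else 0) (fun i => f i)
    (fun i j => if (i : ℕ) = j + 1 then 1 else 0) (fun i => by split_ifs <;> simp) ?_ ?_
  · intro i n
    by_cases h : n + 1 = i
    · rw [if_pos h, Finset.sum_eq_single ⟨n, by omega⟩]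
      · simp [h]
      · intro j _ hj
        have : n ≠ j := fun e => hj (Fin.ext e.symm)
        simp [this]
      · simp
    · rw [if_neg h, eq_comm, Finset.sum_eq_zero]
      intro j _
      split_ifs with h₁ h₂ <;> first | rfl | omega
  · intro n
    by_cases h : n < K + 1
    · rw [Finset.sum_eq_single ⟨n, h⟩]
      · simp
      · intro j _ hj
        have : n ≠ j := fun e => hj (Fin.ext e.symm)
        simp [this]
      · simp
    · rw [hK' n (by omega), eq_comm, Finset.sum_eq_zero]
      intro j _
      rw [if_neg (by omega), mul_zero]

/-- The indicators of residue classes mod `p` are permuted cyclically by the shift. -/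
theorem isTileCountingFunction_of_periodic {f : ℕ → ℕ} {p : ℕ} (hp : 0 < p)
    (hf : Function.Periodic f p) : IsTileCountingFunction f := by
  refine isTileCountingFunction_of_recurrence (ι := Fin p)
    (fun i n => if n % p = i then 1 else 0) (fun i => f i)
    (fun i j => if (j + 1 : ℕ) % p = i then 1 else 0) (fun i => by split_ifs <;> simp) ?_ ?_
  · intro i n
    rw [Finset.sum_eq_single ⟨n % p, Nat.mod_lt n hp⟩]
    · simp
    · intro j _ hj
      have : n % p ≠ j := fun e => hj (Fin.ext e.symm)
      simp [this]
    · simp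
  · intro n
    rw [Finset.sum_eq_single ⟨n % p, Nat.mod_lt n hp⟩]
    · simp [hf.map_mod_nat]
    · intro j _ hj
      have : n % p ≠ j := fun e => hj (Fin.ext e.symm)
      simp [this]
    · simp

/-- The binomial theorem expresses (n + 1)^i through the n^j with coefficients in ℕ, and 0^i ≤ 1. -/
theorem isTileCountingFunction_polynomial (P : Polynomial ℕ) :
    IsTileCountingFunction fun n => P.eval n := by
  refine isTileCountingFunction_of_recurrence (ι := Fin (P.natDegree + 1))
    (fun i n => n ^ (i : ℕ)) (fun i => P.coeff i) (fun i j => (i : ℕ).choose j)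
    (fun i => pow_le_one₀ le_rfl zero_le_one) ?_ ?_
  · intro i n
    rw [add_pow, ← Finset.sum_range fun j => (i : ℕ).choose j * n ^ j]
    refine (Finset.sum_congr rfl fun j _ => by rw [one_pow, mul_one, mul_comm]; rfl).trans
      (Finset.sum_subset (Finset.range_subset_range.2 (Nat.succ_le_of_lt i.2)) fun j _ hj => ?_)
    rw [Nat.choose_eq_zero_of_lt (by simpa [Nat.lt_succ_iff] using hj), zero_mul]
  · intro n
    rw [Polynomial.eval_eq_sum_range, Finset.sum_range]

theorem isTileCountingFunction_pow (m : ℕ) : IsTileCountingFunction fun n => m ^ n :=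
  isTileCountingFunction_of_recurrence (ι := Unit) (fun _ n => m ^ n) 1 (fun _ _ => m)
    (fun _ => by simp) (fun _ n => by simp [pow_succ, mul_comm]) (fun n => by simp)

/-- The constant 1 is the auxiliary state: m^(n+1) - 1 = m(m^n - 1) + (m - 1) · 1. -/
theorem isTileCountingFunction_pow_sub_one {m : ℕ} (hm : 1 ≤ m) :
    IsTileCountingFunction fun n => m ^ n - 1 := by
  refine isTileCountingFunction_of_recurrence (ι := Bool)
    (fun b n => if b then 1 else m ^ n - 1) (fun b => if b then 0 else 1)
    (fun b c => if b then (if c then 1 else 0) else (if c then m - 1 else m))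
    (fun b => by split_ifs <;> simp) ?_ (fun n => by simp)
  rintro (_ | _) n
  · obtain ⟨k, hk⟩ : ∃ k, m ^ n = k + 1 := Nat.exists_eq_add_of_le' (Nat.one_le_pow n m hm)
    obtain ⟨l, rfl⟩ : ∃ l, m = l + 1 := Nat.exists_eq_add_of_le' hm
    simp [pow_succ, hk]
    grind
  · simp

end IrrationalTiling

theorem corollaryc :
    (∀ f : ℕ → ℕ, (Function.support f).Finite →
      IrrationalTiling.IsTileCountingFunction f) ∧
    (∀ (f : ℕ → ℕ) (p : ℕ), 0 < p → Function.Periodic f p →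
      IrrationalTiling.IsTileCountingFunction f) ∧
    (∀ P : Polynomial ℕ, IrrationalTiling.IsTileCountingFunction (fun n => P.eval n)) ∧
    (∀ m : ℕ, IrrationalTiling.IsTileCountingFunction (fun n => m ^ n)) ∧
    (∀ m : ℕ, 1 ≤ m → IrrationalTiling.IsTileCountingFunction (fun n => m ^ n - 1)) :=
  ⟨fun _ => IrrationalTiling.isTileCountingFunction_of_finite_support,
    fun _ _ => IrrationalTiling.isTileCountingFunction_of_periodic,
    IrrationalTiling.isTileCountingFunction_polynomial,
    IrrationalTiling.isTileCountingFunction_pow,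
    fun _ => IrrationalTiling.isTileCountingFunction_pow_sub_one⟩
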